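/- For an integer $K\ge 1$ and a Euclidean space $\mathbb R^n$, let $GMM_n(K)$ be the set of probability measures on $\mathbb R^n$ of the form $\sum_{k=1}^{K}\pi_k\,\mathcal N(m_k,\Sigma_k)$, where $\pi_k\ge 0$, $\sum_{k=1}^K\pi_k=1$, $m_k\in\mathbb R^n$ and $\Sigma_k$ is a symmetric positive semidefinite matrix (degenerate Gaussians and zero weights are allowed, so these are the Gaussian mixtures with at most $K$ components), and let $GMM_n(\infty)=\bigcup_{K\ge1}GMM_n(K)$. For probability measures $\mu_0,\mu_1$ on $\mathbb R^d$, let $\Pi(\mu_0,\mu_1)$ be the set of probability measures on $\mathbb R^d\times\mathbb R^d=\mathbb R^{2d}$ with first marginal $\mu_0$ and second marginal $\mu_1$. Let $d,K_0,K_1\ge 1$, $\mu_0\in GMM_d(K_0)$ and $\mu_1\in GMM_d(K_1)$. Then the infimum $$MW_2^2(\mu_0,\mu_1)=\inf_{\gamma\in\Pi(\mu_0,\mu_1)\cap GMM_{2d}(\infty)}\int_{\mathbb R^d\times\mathbb R^d}\|y_0-y_1\|^2\,d\gamma(y_0,y_1)$$ is attained by some $\gamma^*\in\Pi(\mu_0,\mu_1)\cap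 GMM_{2d}(K_0+K_1-1)$. -/

import Mathlib

open MeasureTheory ProbabilityTheory
open scoped NNReal ENNReal

noncomputable section

/-- `GMM E K`: the probability measures on `E` that are finite Gaussian mixtures with at most `K`
components, i.e. `∑ k, π k • ν k` with `π` in the simplex (zero weights allowed) and every `ν k`
a Gaussian measure, possibly degenerate. Gaussianity depends only on the topology and the linear
structure of `E`, so `E` may be the product `ℝ^d × ℝ^d`, identified with `ℝ^(2d)`. -/
def GMM (E : Type*) [TopologicalSpace E] [AddCommMonoid E] [Module ℝ E] [MeasurableSpace E]
    (K : ℕ) : Set (Measure E) :=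
  {μ | ∃ (π : Fin K → ℝ≥0) (ν : Fin K → Measure E),
    ∑ k, π k = 1 ∧ (∀ k, IsGaussian (ν k)) ∧ μ = ∑ k, π k • ν k}

/-- The set of all finite Gaussian mixtures on `E`. -/
def GMMInf (E : Type*) [TopologicalSpace E] [AddCommMonoid E] [Module ℝ E] [MeasurableSpace E] :
    Set (Measure E) :=
  ⋃ K : ℕ, GMM E K

/-- The transport plans between `μ₀` and `μ₁`: probability measures on `E × E` with marginals
`μ₀` and `μ₁`. -/
def transportPlans {E : Type*} [MeasurableSpace E] (μ₀ μ₁ : Measure E) : Set (Measure (E × E)) :=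
  {γ | IsProbabilityMeasure γ ∧ γ.map Prod.fst = μ₀ ∧ γ.map Prod.snd = μ₁}

/-- The quadratic transport cost `∫ ‖y₀ - y₁‖² dγ(y₀, y₁)`, for the Euclidean norm on `ℝ^d`. -/
def quadCost {d : ℕ}
    (γ : Measure (EuclideanSpace ℝ (Fin d) × EuclideanSpace ℝ (Fin d))) : ℝ≥0∞ :=
  ∫⁻ y, ENNReal.ofReal (‖y.1 - y.2‖ ^ 2) ∂γ

/-- The squared mixture Wasserstein distance `MW₂²(μ₀, μ₁)`: the infimum of the quadratic cost over
the transport plans that are finite Gaussian mixtures. -/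
def MW2Sq {d : ℕ} (μ₀ μ₁ : Measure (EuclideanSpace ℝ (Fin d))) : ℝ≥0∞ :=
  ⨅ γ ∈ transportPlans μ₀ μ₁ ∩ GMMInf (EuclideanSpace ℝ (Fin d) × EuclideanSpace ℝ (Fin d)),
    quadCost γ

end

/-! A plan that is a Gaussian mixture splits into Gaussian pieces, and each piece has Gaussian
marginals. Finite Gaussian mixtures are identifiable (`gaussianMixture_weights_unique`), so the
marginals of the pieces carrying mass must be components of `μ₀` and `μ₁`. The masses therefore form
a discrete plan between the two weight vectors, and its cost for the pairwise costs `gaussianCost`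
is at most that of the mixture plan (`exists_discrete_plan_of_mem_GMMInf`).

Conversely, the least cost of a Gaussian coupling of two components is attained, by compactness
(`exists_optimal_gaussianPlan`), so superposing optimal couplings realises any discrete plan at its
discrete cost. What remains is a finite linear program. It has an optimal vertex, whose support is
small because the row and column constraints satisfy one linear relation
(`exists_sparse_optimal_transport`). -/

/-! ### Linear independence of exponentials of quadratics -/

open Filter Topology in
lemma tendsto_linear_add_quadratic_atBot {m v : ℝ} (h : v < 0 ∨ v = 0 ∧ m < 0) :
    Tendsto (fun t : ℝ ↦ m * t + v * t ^ 2 / 2) atTop atBot := by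
  rcases h with hv | ⟨rfl, hm⟩
  · have h1 : Tendsto (fun t : ℝ ↦ m + v / 2 * t) atTop atBot :=
      tendsto_atBot_add_const_left _ _ (tendsto_id.const_mul_atTop_of_neg (by linarith))
    refine (h1.atBot_mul_atTop₀ tendsto_id).congr fun t ↦ ?_
    simp only [id]; ring
  · simpa using tendsto_id.const_mul_atTop_of_neg hm

open Filter Topology in
/-- Exponentials of distinct quadratic polynomials without constant term are linearly
independent. -/
lemma eq_zero_of_sum_exp_quadratic_eq_zero {ι : Type*} [DecidableEq ι] (s : Finset ι)
    (m v a : ι → ℝ) (hinj : ∀ i ∈ s, ∀ j ∈ s, m i = m j → v i = v j → i = j)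
    (h : ∀ t : ℝ, ∑ i ∈ s, a i * Real.exp (m i * t + v i * t ^ 2 / 2) = 0) :
    ∀ i ∈ s, a i = 0 := by
  -- The lexicographically largest `(v, m)` dominates as `t → ∞`: after division by its exponential,
  -- every other term tends to `0`.
  induction s using Finset.induction_on_max_value (fun i ↦ toLex (v i, m i)) with
  | empty => simp
  | insert k s hk hmax ih =>
    have hlt : ∀ i ∈ s, v i - v k < 0 ∨ v i - v k = 0 ∧ m i - m k < 0 := by
      intro i hi
      have hne : i ≠ k := fun e ↦ hk (e ▸ hi)
      have h1 := hmax i hi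
      rw [Prod.Lex.toLex_le_toLex] at h1
      rcases h1 with h1 | ⟨h1, h2⟩
      · left; simpa using h1
      · right
        refine ⟨sub_eq_zero.2 h1, sub_neg.2 (lt_of_le_of_ne h2 fun e ↦ hne ?_)⟩
        exact hinj i (by simp [hi]) k (by simp) e h1
    have hlim : Tendsto (fun t : ℝ ↦ a k + ∑ i ∈ s, a i *
        Real.exp ((m i - m k) * t + (v i - v k) * t ^ 2 / 2)) atTop
        (𝓝 (a k + ∑ i ∈ s, a i * 0)) := by
      refine tendsto_const_nhds.add (tendsto_finsetSum _ fun i hi ↦ ?_)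
      exact (Real.tendsto_exp_atBot.comp
        (tendsto_linear_add_quadratic_atBot (hlt i hi))).const_mul _
    have hzero : ∀ t : ℝ, a k + ∑ i ∈ s, a i *
        Real.exp ((m i - m k) * t + (v i - v k) * t ^ 2 / 2) = 0 := by
      intro t
      have h1 := congrArg (· * Real.exp (-(m k * t + v k * t ^ 2 / 2))) (h t)
      simp only [Finset.sum_insert hk, add_mul, zero_mul, Finset.sum_mul, mul_assoc,
        ← Real.exp_add] at h1
      rw [← h1]
      congr 1
      · simp
      · refine Finset.sum_congr rfl fun i _ ↦ ?_
        congr 2; ring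
    have hak : a k = 0 := by
      have := tendsto_nhds_unique hlim (by simp only [hzero]; exact tendsto_const_nhds)
      simpa using this
    intro i hi
    rcases Finset.mem_insert.1 hi with rfl | hi
    · exact hak
    · refine ih (fun i hi j hj ↦ hinj i (by simp [hi]) j (by simp [hj])) (fun t ↦ ?_) i hi
      simpa [Finset.sum_insert hk, hak] using h t

/-! ### Identifiability of finite Gaussian mixtures -/

section Identifiability

variable {E : Type*} [NormedAddCommGroup E] [NormedSpace ℝ E] [MeasurableSpace E] [BorelSpace E]

/-- The logarithm of the moment generating function of a Gaussian measure. -/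
noncomputable def gaussianExponent (μ : Measure E) (L : StrongDual ℝ E) : ℝ :=
  L (∫ x, x ∂μ) + covarianceBilinDual μ L L / 2

lemma analyticOnNhd_gaussianExponent (μ : Measure E) :
    AnalyticOnNhd ℝ (gaussianExponent μ) Set.univ := by
  intro L _
  have h1 : AnalyticAt ℝ (fun L : StrongDual ℝ E ↦ L (∫ x, x ∂μ)) L :=
    (ContinuousLinearMap.apply ℝ ℝ (∫ x, x ∂μ)).analyticAt L
  have h2 : AnalyticAt ℝ (fun L : StrongDual ℝ E ↦ covarianceBilinDual μ L L) L :=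
    AnalyticAt.fun_comp (f := fun L : StrongDual ℝ E ↦ (L, L))
      ((covarianceBilinDual μ).analyticAt_bilinear (L, L)) (analyticAt_id.prod analyticAt_id)
  exact h1.add (h2.div_const)

variable [FiniteDimensional ℝ E]

/-- The mean is the odd part of the exponent and the covariance its even part, so comparing values
at `L` and `-L` recovers both. -/
lemma eq_of_gaussianExponent_eq {μ ν : Measure E} [IsGaussian μ] [IsGaussian ν]
    (h : gaussianExponent μ = gaussianExponent ν) : μ = ν := by
  have hodd : ∀ L : StrongDual ℝ E, L (∫ x, x ∂μ) = L (∫ x, x ∂ν) := by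
    intro L
    have h1 := congrFun h L
    have h2 := congrFun h (-L)
    simp only [gaussianExponent, map_neg, neg_apply] at h1 h2
    linarith
  have hcov : ∀ L : StrongDual ℝ E, covarianceBilinDual μ L L = covarianceBilinDual ν L L := by
    intro L
    have h1 := congrFun h L
    simp only [gaussianExponent, hodd L] at h1
    linarith
  refine Measure.ext_of_charFunDual ?_
  ext L
  simp only [IsGaussian.charFunDual_eq', id, hodd L, hcov L]

/-- Finitely many distinct Gaussian measures are separated by a single linear functional. -/
lemma exists_dual_separating (s : Finset (Measure E)) (hs : ∀ ν ∈ s, IsGaussian ν) :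
    ∃ L : StrongDual ℝ E, ∀ μ ∈ s, ∀ ν ∈ s,
      gaussianExponent μ L = gaussianExponent ν L → μ = ν := by
  classical
  have hcont : ∀ μ : Measure E, Continuous (gaussianExponent μ) := fun μ ↦
    continuousOn_univ.1 (analyticOnNhd_gaussianExponent μ).continuousOn
  let D : Measure E × Measure E → Set (StrongDual ℝ E) := fun p ↦
    {L | gaussianExponent p.1 L ≠ gaussianExponent p.2 L}
  have hopen : ∀ p ∈ s.offDiag, IsOpen (D p) := fun p _ ↦
    (isOpen_ne_fun (hcont p.1) (hcont p.2))
  have hdense : ∀ p ∈ s.offDiag, Dense (D p) := by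
    intro p hp
    obtain ⟨h1, h2, hne⟩ := Finset.mem_offDiag.1 hp
    have := hs _ h1
    have := hs _ h2
    -- If two exponents agreed on a nonempty open set, analyticity would make them agree everywhere,
    -- and the two measures would coincide.
    rw [← compl_compl (D p), ← interior_eq_empty_iff_dense_compl]
    by_contra hcon
    obtain ⟨L, hL⟩ := Set.nonempty_iff_ne_empty.2 hcon
    refine hne (eq_of_gaussianExponent_eq ?_)
    have hev : gaussianExponent p.1 =ᶠ[nhds L] gaussianExponent p.2 := by
      filter_upwards [mem_interior_iff_mem_nhds.1 hL] with x hx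
      simpa [D] using hx
    exact (analyticOnNhd_gaussianExponent p.1).eq_of_eventuallyEq
      (analyticOnNhd_gaussianExponent p.2) hev
  have : Dense (⋂ p ∈ (s.offDiag : Set (Measure E × Measure E)), D p) :=
    dense_biInter_of_isOpen hopen s.offDiag.countable_toSet hdense
  obtain ⟨L, hL⟩ := this.nonempty
  refine ⟨L, fun μ hμ ν hν he ↦ ?_⟩
  by_contra hne
  exact Set.mem_iInter₂.1 hL (μ, ν) (Finset.mem_offDiag.2 ⟨hμ, hν, hne⟩) he

lemma integral_exp_dual_of_isGaussian (μ : Measure E) [IsGaussian μ] (L : StrongDual ℝ E) (t : ℝ) :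
    ∫ x, Real.exp (t * L x) ∂μ =
      Real.exp (L (∫ x, x ∂μ) * t + covarianceBilinDual μ L L * t ^ 2 / 2) := by
  have h := mgf_gaussianReal (IsGaussian.map_eq_gaussianReal (μ := μ) L) t
  rw [mgf] at h
  rw [h, IsGaussian.integral_dual, covarianceBilinDual_self_eq_variance IsGaussian.memLp_two_id,
    Real.coe_toNNReal _ (variance_nonneg _ _)]

/-- A non-integrable function has integral `0` by convention, whereas the formula above gives a
positive value. -/
lemma integrable_exp_dual_of_isGaussian (μ : Measure E) [IsGaussian μ] (L : StrongDual ℝ E)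
    (t : ℝ) : Integrable (fun x ↦ Real.exp (t * L x)) μ := by
  by_contra h
  have h1 := integral_exp_dual_of_isGaussian μ L t
  rw [integral_undef h] at h1
  exact (Real.exp_pos _).ne h1

/-- Identifiability of Gaussian mixtures: the weights of a mixture of distinct Gaussian measures
are determined by the mixture. -/
theorem gaussianMixture_weights_unique (s : Finset (Measure E)) (hs : ∀ ν ∈ s, IsGaussian ν)
    (w w' : Measure E → ℝ≥0) (h : ∑ ν ∈ s, w ν • ν = ∑ ν ∈ s, w' ν • ν) :
    ∀ ν ∈ s, w ν = w' ν := by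
  classical
  obtain ⟨L, hL⟩ := exists_dual_separating s hs
  have key : ∀ (u : Measure E → ℝ≥0) (t : ℝ), ∫ x, Real.exp (t * L x) ∂(∑ ν ∈ s, u ν • ν) =
      ∑ ν ∈ s, (u ν : ℝ) *
        Real.exp (L (∫ x, x ∂ν) * t + covarianceBilinDual ν L L * t ^ 2 / 2) := by
    intro u t
    rw [integral_finsetSum_measure]
    · refine Finset.sum_congr rfl fun ν hν ↦ ?_
      have := hs ν hν
      rw [integral_smul_nnreal_measure, integral_exp_dual_of_isGaussian, NNReal.smul_def,
        smul_eq_mul]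
    · intro ν hν
      have := hs ν hν
      exact (integrable_exp_dual_of_isGaussian ν L t).smul_measure_nnreal
  -- Integrating `exp (t * L x)` reduces the claim to one real variable. The choice of `L` keeps the
  -- pairs (mean, variance) distinct.
  have := eq_zero_of_sum_exp_quadratic_eq_zero s (fun ν ↦ L (∫ x, x ∂ν))
    (fun ν ↦ covarianceBilinDual ν L L) (fun ν ↦ (w ν : ℝ) - w' ν)
    (fun μ hμ ν hν h1 h2 ↦ hL μ hμ ν hν (by simp only [gaussianExponent, h1, h2]))
    (fun t ↦ by
      simp only [sub_mul, Finset.sum_sub_distrib]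
      rw [← key w t, ← key w' t, h, sub_self])
  intro ν hν
  exact NNReal.coe_injective (sub_eq_zero.1 (this ν hν))

end Identifiability

/-! ### Optimal Gaussian couplings of two Gaussian measures -/

section GaussianCoupling

lemma isGaussian_ext_of_coord {ι : Type*} [Fintype ι] {μ ν : Measure (EuclideanSpace ℝ ι)}
    [IsGaussian μ] [IsGaussian ν] (hm : ∀ i, ∫ x, x i ∂μ = ∫ x, x i ∂ν)
    (hc : ∀ i j, cov[fun x ↦ x i, fun x ↦ x j; μ] = cov[fun x ↦ x i, fun x ↦ x j; ν]) :
    μ = ν := by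
  classical
  refine IsGaussian.ext ?_ ?_
  · ext i
    have h : ∀ (ρ : Measure (EuclideanSpace ℝ ι)) [IsGaussian ρ],
        (∫ x, x ∂ρ) i = ∫ x, x i ∂ρ := fun ρ _ ↦
      (IsGaussian.integral_dual (μ := ρ) (EuclideanSpace.proj i)).symm
    simpa only [id, h] using hm i
  · have h : ∀ (ρ : Measure (EuclideanSpace ℝ ι)) [IsGaussian ρ] (i j : ι),
        covarianceBilin ρ (EuclideanSpace.basisFun ι ℝ i) (EuclideanSpace.basisFun ι ℝ j) =
          cov[fun x ↦ x i, fun x ↦ x j; ρ] := by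
      intro ρ _ i j
      rw [covarianceBilin_apply_eq_cov IsGaussian.memLp_two_id]
      simp [PiLp.inner_apply]
    have h2 : ∀ i, covarianceBilin μ (EuclideanSpace.basisFun ι ℝ i) =
        covarianceBilin ν (EuclideanSpace.basisFun ι ℝ i) := by
      intro i
      refine ContinuousLinearMap.coe_injective
        ((EuclideanSpace.basisFun ι ℝ).toBasis.ext fun j ↦ ?_)
      simpa only [OrthonormalBasis.coe_toBasis, ContinuousLinearMap.coe_coe, h] using hc i j
    refine ContinuousLinearMap.coe_injective
      ((EuclideanSpace.basisFun ι ℝ).toBasis.ext fun i ↦ ?_)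
    simpa only [OrthonormalBasis.coe_toBasis, ContinuousLinearMap.coe_coe] using h2 i

variable {d : ℕ}

/-- The coordinate functionals on `ℝ^d × ℝ^d`. -/
noncomputable def pairCoord (d : ℕ) (i : Fin d ⊕ Fin d) :
    StrongDual ℝ (EuclideanSpace ℝ (Fin d) × EuclideanSpace ℝ (Fin d)) :=
  Sum.elim (fun i ↦ (EuclideanSpace.proj i).comp (ContinuousLinearMap.fst ℝ _ _))
    (fun i ↦ (EuclideanSpace.proj i).comp (ContinuousLinearMap.snd ℝ _ _)) i

@[simp]
lemma pairCoord_inl (i : Fin d) (y : EuclideanSpace ℝ (Fin d) × EuclideanSpace ℝ (Fin d)) :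
    pairCoord d (Sum.inl i) y = y.1 i := rfl

@[simp]
lemma pairCoord_inr (i : Fin d) (y : EuclideanSpace ℝ (Fin d) × EuclideanSpace ℝ (Fin d)) :
    pairCoord d (Sum.inr i) y = y.2 i := rfl

/-- The covariance matrix of a measure on `ℝ^d × ℝ^d`. -/
noncomputable def pairCovMatrix
    (γ : Measure (EuclideanSpace ℝ (Fin d) × EuclideanSpace ℝ (Fin d))) :
    Matrix (Fin d ⊕ Fin d) (Fin d ⊕ Fin d) ℝ :=
  fun i j ↦ cov[pairCoord d i, pairCoord d j; γ]

/-- The quadratic form at `x` is the variance of the linear functional with coefficients `x`. -/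
lemma posSemidef_pairCovMatrix
    (γ : Measure (EuclideanSpace ℝ (Fin d) × EuclideanSpace ℝ (Fin d))) [IsGaussian γ] :
    (pairCovMatrix γ).PosSemidef := by
  refine Matrix.PosSemidef.of_dotProduct_mulVec_nonneg ?_ fun x ↦ ?_
  · ext i j
    simp [pairCovMatrix, covariance_comm]
  · have h : star x ⬝ᵥ (pairCovMatrix γ).mulVec x = Var[⇑(∑ i, x i • pairCoord d i); γ] := by
      rw [← covarianceBilinDual_self_eq_variance IsGaussian.memLp_two_id]
      simp only [map_sum, map_smul, sum_apply, smul_apply,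
        covarianceBilinDual_eq_covariance IsGaussian.memLp_two_id, dotProduct, Matrix.mulVec,
        pairCovMatrix, smul_eq_mul, Finset.mul_sum, Pi.star_apply, star_trivial]
      rw [Finset.sum_comm]
      refine Finset.sum_congr rfl fun i _ ↦ Finset.sum_congr rfl fun j _ ↦ ?_
      rw [covariance_comm]
      ring
    rw [h]
    exact variance_nonneg _ _

/-- The positive semidefinite matrices with prescribed diagonal blocks. -/
def couplingMatrices (A B : Matrix (Fin d) (Fin d) ℝ) :
    Set (Matrix (Fin d ⊕ Fin d) (Fin d ⊕ Fin d) ℝ) :=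
  {S | S.PosSemidef ∧ S.toBlocks₁₁ = A ∧ S.toBlocks₂₂ = B}

/-- Test the form on `e_i + e_j` and `e_i - e_j`. Prescribing the diagonal thus bounds every entry,
which yields compactness below. -/
lemma Matrix.PosSemidef.abs_apply_le {ι : Type*} [Fintype ι] [DecidableEq ι] {S : Matrix ι ι ℝ}
    (hS : S.PosSemidef) (i j : ι) : |S i j| ≤ (S i i + S j j) / 2 := by
  have hsym : S j i = S i j := by simpa using hS.1.apply i j
  have h1 := hS.dotProduct_mulVec_nonneg (Pi.single i 1 + Pi.single j 1)
  have h2 := hS.dotProduct_mulVec_nonneg (Pi.single i 1 - Pi.single j 1)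
  simp [Matrix.mulVec_add, Matrix.mulVec_sub, add_dotProduct, sub_dotProduct, hsym] at h1 h2
  rw [abs_le]
  constructor <;> linarith

lemma isCompact_couplingMatrices (A B : Matrix (Fin d) (Fin d) ℝ) :
    IsCompact (couplingMatrices A B) := by
  have hclosed : IsClosed (couplingMatrices A B) := by
    have h1 : IsClosed {S : Matrix (Fin d ⊕ Fin d) (Fin d ⊕ Fin d) ℝ | S.PosSemidef} := by
      simp only [Matrix.posSemidef_iff_dotProduct_mulVec, Set.ofPred_and, Set.ofPred_forall]
      refine IsClosed.inter ?_ (isClosed_iInter fun x ↦ ?_)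
      · exact isClosed_eq (by fun_prop) (by fun_prop)
      · exact isClosed_le (by fun_prop) (by fun_prop)
    refine h1.inter (IsClosed.inter ?_ ?_)
    · exact isClosed_eq (by unfold Matrix.toBlocks₁₁; fun_prop) (by fun_prop)
    · exact isClosed_eq (by unfold Matrix.toBlocks₂₂; fun_prop) (by fun_prop)
  let D : Fin d ⊕ Fin d → ℝ := Sum.elim (fun i ↦ A i i) (fun i ↦ B i i)
  let M : (Fin d ⊕ Fin d) → (Fin d ⊕ Fin d) → ℝ := fun i j ↦ (D i + D j) / 2
  have hsub : couplingMatrices A B ⊆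
      Set.univ.pi fun i ↦ Set.univ.pi fun j ↦ Set.Icc (-M i j) (M i j) := by
    rintro S ⟨hS, hA, hB⟩
    have hD : ∀ i, S i i = D i := by
      rintro (i | i)
      · exact congrFun (congrFun hA i) i
      · exact congrFun (congrFun hB i) i
    have h : ∀ i j, |S i j| ≤ M i j := fun i j ↦ by
      simpa only [M, ← hD] using hS.abs_apply_le i j
    exact fun i _ j _ ↦ abs_le.1 (h i j)
  exact IsCompact.of_isClosed_subset
    (isCompact_univ_pi fun i ↦ isCompact_univ_pi fun j ↦ isCompact_Icc) hclosed hsub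

/-- The identification of `ℝ^(2d)` with `ℝ^d × ℝ^d`. -/
noncomputable def splitCoord (d : ℕ) : EuclideanSpace ℝ (Fin d ⊕ Fin d) →L[ℝ]
    EuclideanSpace ℝ (Fin d) × EuclideanSpace ℝ (Fin d) :=
  ((EuclideanSpace.equiv (Fin d) ℝ).symm.toContinuousLinearMap.comp
    (ContinuousLinearMap.pi fun i ↦ EuclideanSpace.proj (Sum.inl i))).prod
  ((EuclideanSpace.equiv (Fin d) ℝ).symm.toContinuousLinearMap.comp
    (ContinuousLinearMap.pi fun i ↦ EuclideanSpace.proj (Sum.inr i)))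

@[simp]
lemma splitCoord_fst (x : EuclideanSpace ℝ (Fin d ⊕ Fin d)) (i : Fin d) :
    (splitCoord d x).1 i = x (Sum.inl i) := rfl

@[simp]
lemma splitCoord_snd (x : EuclideanSpace ℝ (Fin d ⊕ Fin d)) (i : Fin d) :
    (splitCoord d x).2 i = x (Sum.inr i) := rfl

/-- The covariance matrix of a measure on a Euclidean space. -/
noncomputable def covMatrix (μ : Measure (EuclideanSpace ℝ (Fin d))) : Matrix (Fin d) (Fin d) ℝ :=
  fun i j ↦ cov[fun x ↦ x i, fun x ↦ x j; μ]

/-- The Gaussian measures on `ℝ^d × ℝ^d` with given marginals. -/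
def gaussianPlans (μ ν : Measure (EuclideanSpace ℝ (Fin d))) :
    Set (Measure (EuclideanSpace ℝ (Fin d) × EuclideanSpace ℝ (Fin d))) :=
  {γ | IsGaussian γ ∧ γ.map Prod.fst = μ ∧ γ.map Prod.snd = ν}

lemma pairCovMatrix_mem_couplingMatrices {μ ν : Measure (EuclideanSpace ℝ (Fin d))}
    {γ : Measure (EuclideanSpace ℝ (Fin d) × EuclideanSpace ℝ (Fin d))}
    (hγ : γ ∈ gaussianPlans μ ν) :
    pairCovMatrix γ ∈ couplingMatrices (covMatrix μ) (covMatrix ν) := by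
  obtain ⟨hG, rfl, rfl⟩ := hγ
  refine ⟨posSemidef_pairCovMatrix γ, ?_, ?_⟩
  · ext i j
    rw [covMatrix, covariance_map (by fun_prop) (by fun_prop) (by fun_prop)]
    rfl
  · ext i j
    rw [covMatrix, covariance_map (by fun_prop) (by fun_prop) (by fun_prop)]
    rfl

/-- Take the Gaussian whose mean concatenates the two means and whose covariance is `S`; the
diagonal blocks give the right marginals. Optimising over Gaussian plans becomes optimising over a
compact set of matrices. -/
lemma exists_gaussianPlan_of_mem_couplingMatrices {μ ν : Measure (EuclideanSpace ℝ (Fin d))}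
    [IsGaussian μ] [IsGaussian ν] {S : Matrix (Fin d ⊕ Fin d) (Fin d ⊕ Fin d) ℝ}
    (hS : S ∈ couplingMatrices (covMatrix μ) (covMatrix ν)) :
    ∃ γ ∈ gaussianPlans μ ν, pairCovMatrix γ = S := by
  obtain ⟨hpsd, hA, hB⟩ := hS
  let m : EuclideanSpace ℝ (Fin d ⊕ Fin d) :=
    WithLp.toLp 2 (Sum.elim (fun i ↦ ∫ x, x i ∂μ) (fun i ↦ ∫ x, x i ∂ν))
  let G := multivariateGaussian m S
  have hmean : ∀ i, ∫ x, x i ∂G = m i := fun i ↦ by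
    have := IsGaussian.integral_dual (μ := G) (EuclideanSpace.proj i)
    rw [integral_id_multivariateGaussian] at this
    exact this
  have hcov : ∀ i j, cov[fun x ↦ x i, fun x ↦ x j; G] = S i j :=
    covariance_eval_multivariateGaussian hpsd
  refine ⟨G.map (splitCoord d), ⟨inferInstance, ?_, ?_⟩, ?_⟩
  · have : IsGaussian ((G.map (splitCoord d)).map Prod.fst) :=
      isGaussian_map_of_measurable (L := ContinuousLinearMap.fst ℝ _ _) measurable_fst
    refine isGaussian_ext_of_coord (fun i ↦ ?_) fun i j ↦ ?_
    · rw [integral_map (by fun_prop) (by fun_prop), integral_map (by fun_prop) (by fun_prop)]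
      exact hmean (Sum.inl i)
    · rw [covariance_map (by fun_prop) (by fun_prop) (by fun_prop),
        covariance_map (by fun_prop) (by fun_prop) (by fun_prop)]
      exact (hcov (Sum.inl i) (Sum.inl j)).trans (congrFun (congrFun hA i) j)
  · have : IsGaussian ((G.map (splitCoord d)).map Prod.snd) :=
      isGaussian_map_of_measurable (L := ContinuousLinearMap.snd ℝ _ _) measurable_snd
    refine isGaussian_ext_of_coord (fun i ↦ ?_) fun i j ↦ ?_
    · rw [integral_map (by fun_prop) (by fun_prop), integral_map (by fun_prop) (by fun_prop)]
      exact hmean (Sum.inr i)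
    · rw [covariance_map (by fun_prop) (by fun_prop) (by fun_prop),
        covariance_map (by fun_prop) (by fun_prop) (by fun_prop)]
      exact (hcov (Sum.inr i) (Sum.inr j)).trans (congrFun (congrFun hB i) j)
  · ext i j
    rw [pairCovMatrix, covariance_map (by fun_prop) (by fun_prop) (by fun_prop)]
    rw [← hcov i j]
    congr 1
    · rcases i with i | i <;> rfl
    · rcases j with j | j <;> rfl

/-- With the marginals fixed, the plan enters only through the trace of its cross-covariance block,
so least cost means largest trace. -/
lemma quadCost_eq_of_mem_gaussianPlans {μ ν : Measure (EuclideanSpace ℝ (Fin d))}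
    {γ : Measure (EuclideanSpace ℝ (Fin d) × EuclideanSpace ℝ (Fin d))}
    (hγ : γ ∈ gaussianPlans μ ν) :
    quadCost γ = ENNReal.ofReal (∑ i, (∫ x, x i ^ 2 ∂μ + ∫ x, x i ^ 2 ∂ν -
      2 * (pairCovMatrix γ (Sum.inl i) (Sum.inr i) + (∫ x, x i ∂μ) * ∫ x, x i ∂ν))) := by
  obtain ⟨hG, rfl, rfl⟩ := hγ
  have hL : ∀ i, MemLp (pairCoord d i) 2 γ := fun i ↦ IsGaussian.memLp_dual γ _ 2 (by simp)
  have hsq : ∀ i, Integrable (fun y ↦ pairCoord d i y ^ 2) γ := fun i ↦ (hL i).integrable_sq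
  have hmul : ∀ i j, Integrable (fun y ↦ pairCoord d i y * pairCoord d j y) γ := fun i j ↦
    (hL i).integrable_mul (hL j)
  have hexp : ∀ y : EuclideanSpace ℝ (Fin d) × EuclideanSpace ℝ (Fin d),
      ‖y.1 - y.2‖ ^ 2 = ∑ i, (pairCoord d (Sum.inl i) y ^ 2 + pairCoord d (Sum.inr i) y ^ 2 -
        2 * (pairCoord d (Sum.inl i) y * pairCoord d (Sum.inr i) y)) := by
    intro y
    rw [EuclideanSpace.real_norm_sq_eq]
    refine Finset.sum_congr rfl fun i _ ↦ ?_
    simp only [PiLp.sub_apply, pairCoord_inl, pairCoord_inr]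
    ring
  have hint : ∀ i, Integrable (fun y ↦ pairCoord d (Sum.inl i) y ^ 2 +
      pairCoord d (Sum.inr i) y ^ 2 -
        2 * (pairCoord d (Sum.inl i) y * pairCoord d (Sum.inr i) y)) γ := fun i ↦
    ((hsq _).add (hsq _)).sub ((hmul _ _).const_mul 2)
  rw [quadCost, ← ofReal_integral_eq_lintegral_ofReal]
  · congr 1
    simp_rw [hexp]
    rw [integral_finsetSum _ fun i _ ↦ hint i]
    refine Finset.sum_congr rfl fun i _ ↦ ?_
    have hadd : Integrable (fun y ↦ pairCoord d (Sum.inl i) y ^ 2 +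
        pairCoord d (Sum.inr i) y ^ 2) γ := (hsq _).add (hsq _)
    rw [integral_sub hadd ((hmul _ _).const_mul 2), integral_add (hsq _) (hsq _),
      integral_const_mul, pairCovMatrix, covariance_eq_sub (hL _) (hL _),
      integral_map (by fun_prop) (by fun_prop), integral_map (by fun_prop) (by fun_prop),
      integral_map (by fun_prop) (by fun_prop), integral_map (by fun_prop) (by fun_prop)]
    simp
  · simp_rw [hexp]
    exact integrable_finsetSum _ fun i _ ↦ hint i
  · exact Filter.Eventually.of_forall fun y ↦ by positivity

/-- Among the Gaussian couplings of two Gaussian measures there is one of least quadratic cost. -/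
theorem exists_optimal_gaussianPlan (μ ν : Measure (EuclideanSpace ℝ (Fin d)))
    [IsGaussian μ] [IsGaussian ν] :
    ∃ γ ∈ gaussianPlans μ ν, quadCost γ ≠ ⊤ ∧ ∀ γ' ∈ gaussianPlans μ ν,
      quadCost γ ≤ quadCost γ' := by
  have hne : (couplingMatrices (covMatrix μ) (covMatrix ν)).Nonempty :=
    ⟨pairCovMatrix (μ.prod ν), pairCovMatrix_mem_couplingMatrices
      ⟨inferInstance, by simp [Measure.map_fst_prod], by simp [Measure.map_snd_prod]⟩⟩
  obtain ⟨S, hS, hmax⟩ := (isCompact_couplingMatrices (covMatrix μ) (covMatrix ν)).exists_isMaxOn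
    hne (f := fun S ↦ ∑ i : Fin d, S (Sum.inl i) (Sum.inr i))
    (by fun_prop)
  obtain ⟨γ, hγ, rfl⟩ := exists_gaussianPlan_of_mem_couplingMatrices hS
  refine ⟨γ, hγ, ?_, fun γ' hγ' ↦ ?_⟩
  · rw [quadCost_eq_of_mem_gaussianPlans hγ]
    exact ENNReal.ofReal_ne_top
  · rw [quadCost_eq_of_mem_gaussianPlans hγ, quadCost_eq_of_mem_gaussianPlans hγ']
    refine ENNReal.ofReal_le_ofReal ?_
    have h := hmax (pairCovMatrix_mem_couplingMatrices hγ')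
    simp only [Set.mem_ofPred_eq] at h
    simp only [Finset.sum_sub_distrib, ← Finset.mul_sum, Finset.sum_add_distrib]
    linarith

end GaussianCoupling

/-! ### Sparse solutions of discrete optimal transport -/

section DiscreteTransport

variable {ι κ : Type*} [Fintype ι] [Fintype κ]

/-- The transport polytope: nonnegative matrices with row sums `a` and column sums `b`. -/
def transportPolytope (a : ι → ℝ) (b : κ → ℝ) : Set (ι × κ → ℝ) :=
  {w | (∀ p, 0 ≤ w p) ∧ (∀ i, ∑ j, w (i, j) = a i) ∧ ∀ j, ∑ i, w (i, j) = b j}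

lemma isCompact_transportPolytope (a : ι → ℝ) (b : κ → ℝ) :
    IsCompact (transportPolytope a b) := by
  have hclosed : IsClosed (transportPolytope a b) := by
    simp only [transportPolytope, Set.ofPred_and, Set.ofPred_forall]
    refine IsClosed.inter (isClosed_iInter fun p ↦ ?_)
      (IsClosed.inter (isClosed_iInter fun i ↦ ?_) (isClosed_iInter fun j ↦ ?_))
    · exact isClosed_le (by fun_prop) (by fun_prop)
    · exact isClosed_eq (by fun_prop) (by fun_prop)
    · exact isClosed_eq (by fun_prop) (by fun_prop)
  refine IsCompact.of_isClosed_subset (isCompact_Icc (a := fun _ ↦ 0) (b := fun p ↦ a p.1))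
    hclosed fun w hw ↦ ⟨fun p ↦ hw.1 p, fun p ↦ ?_⟩
  simp only [← hw.2.1]
  exact Finset.single_le_sum (f := fun j ↦ w (p.1, j)) (fun j _ ↦ hw.1 _) (Finset.mem_univ p.2)

/-- The row and column sums of a matrix supported in `s`. -/
noncomputable def marginalSums [DecidableEq ι] [DecidableEq κ] (s : Finset (ι × κ)) :
    (s → ℝ) →ₗ[ℝ] (ι → ℝ) × (κ → ℝ) where
  toFun h := (fun i ↦ ∑ p : s, if p.1.1 = i then h p else 0,
    fun j ↦ ∑ p : s, if p.1.2 = j then h p else 0)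
  map_add' g h := by
    ext <;> simp [← Finset.sum_add_distrib] <;> refine Finset.sum_congr rfl fun p _ ↦ ?_ <;>
      split_ifs <;> simp
  map_smul' c h := by
    ext <;> simp [Finset.mul_sum]

/-- Row sums and column sums have the same total, so the range is a proper subspace. This is the
source of the `-1` in the number of components. -/
lemma card_lt_of_injective_marginalSums [DecidableEq ι] [DecidableEq κ] [Nonempty ι]
    (s : Finset (ι × κ)) (hs : Function.Injective (marginalSums s)) :
    s.card < Fintype.card ι + Fintype.card κ := by
  have h1 := LinearMap.finrank_range_of_inj hs
  have h2 : LinearMap.range (marginalSums s) < ⊤ := by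
    refine lt_top_iff_ne_top.2 fun htop ↦ ?_
    obtain ⟨i⟩ := ‹Nonempty ι›
    have hmem : ((Pi.single i 1 : ι → ℝ), (0 : κ → ℝ)) ∈ LinearMap.range (marginalSums s) := by
      rw [htop]; trivial
    obtain ⟨h, hh⟩ := hmem
    have e1 := congrArg (fun q ↦ ∑ i, q.1 i) hh
    have e2 := congrArg (fun q ↦ ∑ j, q.2 j) hh
    simp only [marginalSums, LinearMap.coe_mk, AddHom.coe_mk] at e1 e2
    rw [Finset.sum_comm] at e1 e2
    simp at e1 e2
    rw [e2] at e1
    simp at e1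
  have h3 := Submodule.finrank_lt h2.ne
  rw [h1] at h3
  simpa using h3

/-- A kernel element, extended by zero, is a direction `g` preserving all marginals. Since `g` lives
on the support of `w`, both `w + ε • g` and `w - ε • g` stay in the polytope for small `ε`, and
extremality forces `g = 0`. -/
lemma injective_marginalSums_of_mem_extremePoints [DecidableEq ι] [DecidableEq κ]
    {a : ι → ℝ} {b : κ → ℝ} {w : ι × κ → ℝ}
    (hw : w ∈ Set.extremePoints ℝ (transportPolytope a b)) :
    Function.Injective (marginalSums (Finset.univ.filter fun p ↦ w p ≠ 0)) := by
  set s := Finset.univ.filter fun p ↦ w p ≠ 0 with hs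
  rw [mem_extremePoints] at hw
  obtain ⟨hwP, hext⟩ := hw
  rw [injective_iff_map_eq_zero]
  intro h hh
  let g : ι × κ → ℝ := fun p ↦ if hp : p ∈ s then h ⟨p, hp⟩ else 0
  have hsum : ∀ q : ι × κ → Prop, [DecidablePred q] →
      (∑ p : s, if q p.1 then h p else 0) = ∑ p, if q p then g p else 0 := by
    intro q _
    rw [← Finset.sum_subset (Finset.subset_univ s), ← Finset.sum_coe_sort s]
    · refine Finset.sum_congr rfl fun p _ ↦ ?_
      simp [g]
    · intro p _ hp
      simp [g, hp]
  have hrow : ∀ i, ∑ j, g (i, j) = 0 := by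
    intro i
    have e := congrFun (congrArg Prod.fst hh) i
    simp only [marginalSums, LinearMap.coe_mk, AddHom.coe_mk] at e
    rw [hsum (fun p ↦ p.1 = i), Fintype.sum_prod_type_right] at e
    simpa using e
  have hcol : ∀ j, ∑ i, g (i, j) = 0 := by
    intro j
    have e := congrFun (congrArg Prod.snd hh) j
    simp only [marginalSums, LinearMap.coe_mk, AddHom.coe_mk] at e
    rw [hsum (fun p ↦ p.2 = j), Fintype.sum_prod_type] at e
    simpa using e
  obtain ⟨ε, hε, hle⟩ : ∃ ε > 0, ∀ p, ε * |g p| ≤ w p := by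
    have : ∀ p, ∃ ε > 0, ∀ δ ≤ ε, δ * |g p| ≤ w p := by
      intro p
      by_cases hp : w p = 0
      · refine ⟨1, one_pos, fun δ _ ↦ ?_⟩
        have : g p = 0 := by simp [g, hs, hp]
        simp [this, hp]
      · have hpos : 0 < w p := lt_of_le_of_ne (hwP.1 p) (Ne.symm hp)
        -- The `+ 1` keeps the denominator positive when `g p = 0`.
        refine ⟨w p / (|g p| + 1), by positivity, fun δ hδ ↦ ?_⟩
        calc δ * |g p| ≤ w p / (|g p| + 1) * |g p| := by gcongr
          _ ≤ w p / (|g p| + 1) * (|g p| + 1) := by gcongr; linarith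
          _ = w p := by field_simp
    choose e he hle using this
    rcases isEmpty_or_nonempty (ι × κ) with hemp | hne
    · exact ⟨1, one_pos, fun p ↦ (hemp.false p).elim⟩
    · exact ⟨Finset.univ.inf' Finset.univ_nonempty e, by simpa using he,
        fun p ↦ hle p _ (Finset.inf'_le _ (Finset.mem_univ p))⟩
  have hmem : ∀ δ : ℝ, |δ| = ε → w + δ • g ∈ transportPolytope a b := by
    intro δ hδ
    refine ⟨fun p ↦ ?_, fun i ↦ ?_, fun j ↦ ?_⟩
    · have h1 := hle p
      rw [← hδ, ← abs_mul] at h1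
      have := (abs_le.1 h1).1
      simp only [Pi.add_apply, Pi.smul_apply, smul_eq_mul]
      linarith
    · simp [Finset.sum_add_distrib, ← Finset.mul_sum, hrow, hwP.2.1 i]
    · simp [Finset.sum_add_distrib, ← Finset.mul_sum, hcol, hwP.2.2 j]
  have hg : ε • g = 0 := by
    have := (hext _ (hmem ε (abs_of_pos hε)) _ (hmem (-ε) (by rw [abs_neg, abs_of_pos hε]))
      ⟨1 / 2, 1 / 2, by norm_num, by norm_num, by norm_num, by module⟩).1
    simpa using this
  have hg0 : g = 0 := (smul_eq_zero.1 hg).resolve_left hε.ne'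
  ext p
  have := congrFun hg0 p.1
  simpa [g] using this

/-- The discrete optimal transport problem has a solution with at most `|ι| + |κ| - 1` nonzero
entries. -/
theorem exists_sparse_optimal_transport (a : ι → ℝ) (b : κ → ℝ) (ha : ∀ i, 0 ≤ a i)
    (hb : ∀ j, 0 ≤ b j) (ha1 : ∑ i, a i = 1) (hb1 : ∑ j, b j = 1) (c : ι × κ → ℝ) :
    ∃ w ∈ transportPolytope a b,
      (∀ w' ∈ transportPolytope a b, ∑ p, w p * c p ≤ ∑ p, w' p * c p) ∧
      (Finset.univ.filter fun p ↦ w p ≠ 0).card < Fintype.card ι + Fintype.card κ := by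
  classical
  have hι : Nonempty ι := by
    by_contra hemp
    rw [not_nonempty_iff] at hemp
    simp at ha1
  have hne : (transportPolytope a b).Nonempty :=
    ⟨fun p ↦ a p.1 * b p.2, fun p ↦ mul_nonneg (ha _) (hb _),
      fun i ↦ by simp [← Finset.mul_sum, hb1], fun j ↦ by simp [← Finset.sum_mul, ha1]⟩
  have hcomp := isCompact_transportPolytope a b
  -- Exposed faces consist of maximisers, hence the sign. An extreme point of this face of cost
  -- minimisers is extreme in the whole polytope.
  let l : StrongDual ℝ (ι × κ → ℝ) := -∑ p, c p • ContinuousLinearMap.proj p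
  have hl : ∀ w, l w = -∑ p, w p * c p := by
    intro w
    simp [l, mul_comm]
  have hexp : IsExposed ℝ (transportPolytope a b) (l.toExposed (transportPolytope a b)) :=
    ContinuousLinearMap.toExposed.isExposed
  have hne' : (l.toExposed (transportPolytope a b)).Nonempty := by
    obtain ⟨w, hw, hmax⟩ := hcomp.exists_isMaxOn hne l.continuous.continuousOn
    exact ⟨w, hw, fun y hy ↦ hmax hy⟩
  obtain ⟨w, hw⟩ := (hexp.isCompact hcomp).extremePoints_nonempty hne'
  refine ⟨w, hw.1.1, fun w' hw' ↦ ?_, ?_⟩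
  · have := hw.1.2 w' hw'
    rw [hl, hl] at this
    linarith
  · exact card_lt_of_injective_marginalSums _ (injective_marginalSums_of_mem_extremePoints
      (hexp.isExtreme.extremePoints_subset_extremePoints hw))

end DiscreteTransport

/-! ### Normal forms of mixtures and comparison of weights -/

section Mixtures

variable {E : Type*} [NormedAddCommGroup E] [NormedSpace ℝ E] [MeasurableSpace E]

/-- A Gaussian mixture can be written with distinct components and nonzero weights. -/
lemma exists_finset_of_mem_GMM {K : ℕ} {μ : Measure E} (hμ : μ ∈ GMM E K) :
    ∃ (s : Finset (Measure E)) (w : Measure E → ℝ≥0), s.card ≤ K ∧ (∀ ν ∈ s, IsGaussian ν) ∧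
      (∀ ν ∈ s, w ν ≠ 0) ∧ ∑ ν ∈ s, w ν = 1 ∧ μ = ∑ ν ∈ s, w ν • ν := by
  classical
  obtain ⟨π, ν, hsum, hG, rfl⟩ := hμ
  let t := Finset.univ.filter fun k ↦ π k ≠ 0
  have hmaps : ∀ k ∈ t, ν k ∈ t.image ν := fun k hk ↦ Finset.mem_image_of_mem _ hk
  refine ⟨t.image ν, fun ρ ↦ ∑ k ∈ t with ν k = ρ, π k, ?_, ?_, ?_, ?_, ?_⟩
  · exact Finset.card_image_le.trans ((Finset.card_le_univ t).trans (by simp))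
  · intro ρ hρ
    obtain ⟨k, -, rfl⟩ := Finset.mem_image.1 hρ
    exact hG k
  · intro ρ hρ
    obtain ⟨k, hk, rfl⟩ := Finset.mem_image.1 hρ
    intro h0
    exact (Finset.mem_filter.1 hk).2
      ((Finset.sum_eq_zero_iff.1 h0) k (Finset.mem_filter.2 ⟨hk, rfl⟩))
  · rw [Finset.sum_fiberwise_of_maps_to hmaps, ← hsum]
    exact Finset.sum_filter_ne_zero _
  · calc ∑ k, π k • ν k = ∑ k ∈ t, π k • ν k := by
          refine (Finset.sum_subset (Finset.subset_univ t) fun k _ hk ↦ ?_).symm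
          have : π k = 0 := by simpa [t] using hk
          simp [this]
      _ = ∑ ρ ∈ t.image ν, ∑ k ∈ t with ν k = ρ, π k • ν k :=
          (Finset.sum_fiberwise_of_maps_to hmaps _).symm
      _ = _ := by
          refine Finset.sum_congr rfl fun ρ _ ↦ ?_
          rw [Finset.sum_smul]
          refine Finset.sum_congr rfl fun k hk ↦ ?_
          rw [(Finset.mem_filter.1 hk).2]

lemma sum_smul_mem_GMM [BorelSpace E] {α : Type*} (t : Finset α) {K : ℕ} (hK : t.card ≤ K)
    (u : α → ℝ≥0) (g : α → Measure E) (hu : ∑ a ∈ t, u a = 1) (hg : ∀ a ∈ t, IsGaussian (g a)) :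
    ∑ a ∈ t, u a • g a ∈ GMM E K := by
  classical
  obtain ⟨f⟩ : Nonempty (t ↪ Fin K) := Function.Embedding.nonempty_of_card_le (by simpa using hK)
  let π : Fin K → ℝ≥0 := Function.extend f (fun a ↦ u a) 0
  -- Unused slots get weight zero and a Dirac mass, which is a degenerate Gaussian.
  let ν : Fin K → Measure E := Function.extend f (fun a ↦ g a) fun _ ↦ Measure.dirac 0
  have hπ : ∀ a : t, π (f a) = u a := fun a ↦ f.injective.extend_apply _ _ a
  have hν : ∀ a : t, ν (f a) = g a := fun a ↦ f.injective.extend_apply _ _ a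
  have hπ0 : ∀ k ∉ Set.range f, π k = 0 := fun k hk ↦ Function.extend_apply' _ _ _ hk
  refine ⟨π, ν, ?_, fun k ↦ ?_, ?_⟩
  · rw [← hu, ← Finset.sum_coe_sort t]
    exact (Fintype.sum_of_injective f f.injective _ _ hπ0 fun a ↦ (hπ a).symm).symm
  · by_cases hk : k ∈ Set.range f
    · obtain ⟨a, rfl⟩ := hk
      rw [hν]
      exact hg a a.2
    · have : ν k = Measure.dirac 0 := Function.extend_apply' _ _ _ hk
      rw [this]
      infer_instance
  · rw [← Finset.sum_coe_sort t]
    refine Fintype.sum_of_injective f f.injective _ _ (fun k hk ↦ ?_) fun a ↦ ?_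
    · rw [hπ0 k hk, zero_smul]
    · rw [hπ, hν]

/-- The `f a` may coincide, so weights are summed over fibres before identifiability applies. The
value `0` off `s` later forces the marginals of the pieces of a plan into the list of components. -/
lemma sum_weights_eq_of_mixture_eq [BorelSpace E] [FiniteDimensional ℝ E] [DecidableEq (Measure E)]
    {α : Type*} {t : Finset α} {u : α → ℝ≥0} {f : α → Measure E} (hf : ∀ a ∈ t, IsGaussian (f a))
    {s : Finset (Measure E)} {w : Measure E → ℝ≥0} (hs : ∀ ν ∈ s, IsGaussian ν)
    (h : ∑ a ∈ t, u a • f a = ∑ ν ∈ s, w ν • ν) (ρ : Measure E) (hρ : IsGaussian ρ) :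
    ∑ a ∈ t with f a = ρ, u a = if ρ ∈ s then w ρ else 0 := by
  -- Both mixtures are rewritten over one common family, enlarged by `ρ` in case it occurs in
  -- neither.
  let S := insert ρ (s ∪ t.image f)
  have hS : ∀ ν ∈ S, IsGaussian ν := by
    intro ν hν
    simp only [S, Finset.mem_insert, Finset.mem_union, Finset.mem_image] at hν
    rcases hν with rfl | hν | ⟨a, ha, rfl⟩
    · exact hρ
    · exact hs ν hν
    · exact hf a ha
  refine gaussianMixture_weights_unique S hS (fun ρ ↦ ∑ a ∈ t with f a = ρ, u a)
    (fun ρ ↦ if ρ ∈ s then w ρ else 0) ?_ ρ (Finset.mem_insert_self _ _)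
  have hmaps : ∀ a ∈ t, f a ∈ S := fun a ha ↦
    Finset.mem_insert_of_mem (Finset.mem_union_right _ (Finset.mem_image_of_mem _ ha))
  calc ∑ ν ∈ S, (∑ a ∈ t with f a = ν, u a) • ν
      = ∑ ν ∈ S, ∑ a ∈ t with f a = ν, u a • f a := by
        refine Finset.sum_congr rfl fun ρ _ ↦ ?_
        rw [Finset.sum_smul]
        refine Finset.sum_congr rfl fun k hk ↦ ?_
        rw [(Finset.mem_filter.1 hk).2]
    _ = ∑ a ∈ t, u a • f a := Finset.sum_fiberwise_of_maps_to hmaps _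
    _ = ∑ ν ∈ s, (if ν ∈ s then w ν else 0) • ν := by
        rw [h]
        exact Finset.sum_congr rfl fun ν hν ↦ by rw [if_pos hν]
    _ = ∑ ν ∈ S, (if ν ∈ s then w ν else 0) • ν := by
        refine Finset.sum_subset (fun ν hν ↦ ?_) fun ν _ hν ↦ by simp [hν]
        exact Finset.mem_insert_of_mem (Finset.mem_union_left _ hν)

end Mixtures

/-! ### Reduction to the discrete problem -/

section Main

variable {d : ℕ}

/-- The least quadratic cost of a Gaussian coupling. -/
noncomputable def gaussianCost (μ ν : Measure (EuclideanSpace ℝ (Fin d))) : ℝ≥0∞ :=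
  ⨅ γ ∈ gaussianPlans μ ν, quadCost γ

lemma exists_gaussianPlan_quadCost_eq (μ ν : Measure (EuclideanSpace ℝ (Fin d)))
    [IsGaussian μ] [IsGaussian ν] :
    ∃ γ ∈ gaussianPlans μ ν, quadCost γ = gaussianCost μ ν ∧ gaussianCost μ ν ≠ ⊤ := by
  obtain ⟨γ, hγ, htop, hmin⟩ := exists_optimal_gaussianPlan μ ν
  have h : quadCost γ = gaussianCost μ ν := le_antisymm (le_iInf₂ hmin) (iInf₂_le γ hγ)
  exact ⟨γ, hγ, h, h ▸ htop⟩

lemma quadCost_sum_smul {α : Type*} (t : Finset α) (u : α → ℝ≥0)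
    (g : α → Measure (EuclideanSpace ℝ (Fin d) × EuclideanSpace ℝ (Fin d))) :
    quadCost (∑ a ∈ t, u a • g a) = ∑ a ∈ t, (u a : ℝ≥0∞) * quadCost (g a) := by
  rw [quadCost, lintegral_finsetSum_measure]
  refine Finset.sum_congr rfl fun a _ ↦ ?_
  rw [lintegral_smul_measure]
  rfl

lemma map_sum_smul {α X Y : Type*} [MeasurableSpace X] [MeasurableSpace Y] (t : Finset α)
    (u : α → ℝ≥0) (g : α → Measure X) {f : X → Y} (hf : Measurable f) :
    (∑ a ∈ t, u a • g a).map f = ∑ a ∈ t, u a • (g a).map f := by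
  rw [Measure.map_finset_sum hf.aemeasurable]
  exact Finset.sum_congr rfl fun a _ ↦ Measure.map_smul (u a) (g a) f

/-- A transport plan that is a Gaussian mixture induces a discrete transport plan between the
components, of no larger cost. -/
lemma exists_discrete_plan_of_mem_GMMInf {s₀ s₁ : Finset (Measure (EuclideanSpace ℝ (Fin d)))}
    {w₀ w₁ : Measure (EuclideanSpace ℝ (Fin d)) → ℝ≥0}
    (hG₀ : ∀ ν ∈ s₀, IsGaussian ν) (hG₁ : ∀ ν ∈ s₁, IsGaussian ν)
    {γ : Measure (EuclideanSpace ℝ (Fin d) × EuclideanSpace ℝ (Fin d))}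
    (hγ : γ ∈ transportPlans (∑ ν ∈ s₀, w₀ ν • ν) (∑ ν ∈ s₁, w₁ ν • ν))
    (hmix : γ ∈ GMMInf (EuclideanSpace ℝ (Fin d) × EuclideanSpace ℝ (Fin d))) :
    ∃ W : s₀ × s₁ → ℝ≥0, (∀ i : s₀, ∑ j, W (i, j) = w₀ i) ∧ (∀ j : s₁, ∑ i, W (i, j) = w₁ j) ∧
      ∑ p, (W p : ℝ≥0∞) * gaussianCost p.1.1 p.2.1 ≤ quadCost γ := by
  classical
  obtain ⟨K, hK⟩ := Set.mem_iUnion.1 hmix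
  obtain ⟨t, u, -, hG, hu, -, rfl⟩ := exists_finset_of_mem_GMM hK
  obtain ⟨-, h₀, h₁⟩ := hγ
  rw [map_sum_smul _ _ _ measurable_fst] at h₀
  rw [map_sum_smul _ _ _ measurable_snd] at h₁
  have hGf : ∀ g ∈ t, IsGaussian (g.map Prod.fst) := fun g hg ↦
    have := hG g hg
    isGaussian_map_of_measurable (L := ContinuousLinearMap.fst ℝ _ _) measurable_fst
  have hGs : ∀ g ∈ t, IsGaussian (g.map Prod.snd) := fun g hg ↦
    have := hG g hg
    isGaussian_map_of_measurable (L := ContinuousLinearMap.snd ℝ _ _) measurable_snd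
  have hw₀ := sum_weights_eq_of_mixture_eq hGf hG₀ h₀
  have hw₁ := sum_weights_eq_of_mixture_eq hGs hG₁ h₁
  -- Otherwise the total weight over this marginal would vanish, but every weight `u g` is nonzero.
  have hmem₀ : ∀ g : t, g.1.map Prod.fst ∈ s₀ := by
    intro g
    by_contra hcon
    have h := hw₀ _ (hGf g g.2)
    rw [if_neg hcon] at h
    exact hu g g.2 (Finset.sum_eq_zero_iff.1 h g (Finset.mem_filter.2 ⟨g.2, rfl⟩))
  have hmem₁ : ∀ g : t, g.1.map Prod.snd ∈ s₁ := by
    intro g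
    by_contra hcon
    have h := hw₁ _ (hGs g g.2)
    rw [if_neg hcon] at h
    exact hu g g.2 (Finset.sum_eq_zero_iff.1 h g (Finset.mem_filter.2 ⟨g.2, rfl⟩))
  let q : t → s₀ × s₁ := fun g ↦ (⟨_, hmem₀ g⟩, ⟨_, hmem₁ g⟩)
  refine ⟨fun p ↦ ∑ g : t, if q g = p then u g else 0, fun i ↦ ?_, fun j ↦ ?_, ?_⟩
  · rw [Finset.sum_comm, ← (hw₀ i (hG₀ i i.2)).trans (if_pos i.2), Finset.sum_filter,
      ← Finset.sum_coe_sort t]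
    refine Finset.sum_congr rfl fun g _ ↦ ?_
    rw [Fintype.sum_eq_single (q g).2 fun k hk ↦
      if_neg fun e ↦ hk (congrArg Prod.snd e).symm]
    simp [q, Prod.ext_iff, Subtype.ext_iff]
  · rw [Finset.sum_comm, ← (hw₁ j (hG₁ j j.2)).trans (if_pos j.2), Finset.sum_filter,
      ← Finset.sum_coe_sort t]
    refine Finset.sum_congr rfl fun g _ ↦ ?_
    rw [Fintype.sum_eq_single (q g).1 fun k hk ↦
      if_neg fun e ↦ hk (congrArg Prod.fst e).symm]
    simp [q, Prod.ext_iff, Subtype.ext_iff]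
  · rw [quadCost_sum_smul, ← Finset.sum_coe_sort t]
    calc ∑ p, ((∑ g : t, if q g = p then u g else 0 : ℝ≥0) : ℝ≥0∞) * gaussianCost p.1.1 p.2.1
        = ∑ g : t, (u g : ℝ≥0∞) * gaussianCost (q g).1.1 (q g).2.1 := by
          simp only [ENNReal.ofNNReal_finsetSum, Finset.sum_mul]
          rw [Finset.sum_comm]
          refine Finset.sum_congr rfl fun g _ ↦ ?_
          rw [Finset.sum_eq_single (q g)] <;> simp +contextual [eq_comm]
      _ ≤ _ := by
          refine Finset.sum_le_sum fun g _ ↦ ?_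
          gcongr
          -- Each piece is itself a Gaussian coupling of its own marginals.
          exact iInf₂_le g.1 ⟨hG g g.2, rfl, rfl⟩

end Main

theorem mainTheorem8 {d : ℕ} (K₀ K₁ : ℕ) (μ₀ μ₁ : Measure (EuclideanSpace ℝ (Fin d)))
    (hμ₀ : μ₀ ∈ GMM (EuclideanSpace ℝ (Fin d)) K₀)
    (hμ₁ : μ₁ ∈ GMM (EuclideanSpace ℝ (Fin d)) K₁) :
    ∃ γ ∈ transportPlans μ₀ μ₁ ∩
        GMM (EuclideanSpace ℝ (Fin d) × EuclideanSpace ℝ (Fin d)) (K₀ + K₁ - 1),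
      quadCost γ = MW2Sq μ₀ μ₁ := by
  classical
  obtain ⟨s₀, w₀, hc₀, hG₀, -, hsum₀, rfl⟩ := exists_finset_of_mem_GMM hμ₀
  obtain ⟨s₁, w₁, hc₁, hG₁, -, hsum₁, rfl⟩ := exists_finset_of_mem_GMM hμ₁
  have hopt : ∀ p : s₀ × s₁, ∃ γ ∈ gaussianPlans p.1.1 p.2.1,
      quadCost γ = gaussianCost p.1.1 p.2.1 ∧ gaussianCost p.1.1 p.2.1 ≠ ⊤ := fun p ↦
    have := hG₀ _ p.1.2
    have := hG₁ _ p.2.2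
    exists_gaussianPlan_quadCost_eq _ _
  choose g hg hgcost hfin using hopt
  obtain ⟨w, ⟨hw, hrow, hcol⟩, hmin, hcard⟩ := exists_sparse_optimal_transport
    (fun i : s₀ ↦ (w₀ i : ℝ)) (fun j : s₁ ↦ (w₁ j : ℝ)) (fun _ ↦ NNReal.coe_nonneg _)
    (fun _ ↦ NNReal.coe_nonneg _)
    (by rw [Finset.sum_coe_sort s₀ fun i ↦ (w₀ i : ℝ)]; exact_mod_cast hsum₀)
    (by rw [Finset.sum_coe_sort s₁ fun j ↦ (w₁ j : ℝ)]; exact_mod_cast hsum₁)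
    (fun p ↦ (gaussianCost p.1.1 p.2.1).toReal)
  lift w to s₀ × s₁ → ℝ≥0 using hw
  beta_reduce at hrow hcol
  have hrow' : ∀ i, ∑ j, w (i, j) = w₀ i := fun i ↦ by exact_mod_cast hrow i
  have hcol' : ∀ j, ∑ i, w (i, j) = w₁ j := fun j ↦ by exact_mod_cast hcol j
  have htotal : ∑ p, w p = 1 := by
    rw [Fintype.sum_prod_type]
    simp only [hrow']
    rw [Finset.sum_coe_sort s₀ w₀, hsum₀]
  -- Finiteness of the pairwise costs lets the real-valued linear program speak about extended
  -- costs.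
  have hcost : ∀ W : s₀ × s₁ → ℝ≥0, ∑ p, (W p : ℝ≥0∞) * gaussianCost p.1.1 p.2.1 =
      ENNReal.ofReal (∑ p, (W p : ℝ) * (gaussianCost p.1.1 p.2.1).toReal) := by
    intro W
    rw [ENNReal.ofReal_sum_of_nonneg fun p _ ↦ by positivity]
    refine Finset.sum_congr rfl fun p _ ↦ ?_
    rw [ENNReal.ofReal_mul (by positivity), ENNReal.ofReal_toReal (hfin p),
      ENNReal.ofReal_coe_nnreal]
  have hGMM : ∑ p, w p • g p ∈
      GMM (EuclideanSpace ℝ (Fin d) × EuclideanSpace ℝ (Fin d)) (K₀ + K₁ - 1) := by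
    have hsupp : ∑ p, w p • g p = ∑ p with w p ≠ 0, w p • g p := by
      refine (Finset.sum_subset (Finset.subset_univ _) fun p _ hp ↦ ?_).symm
      have : w p = 0 := by simpa using hp
      rw [this, zero_smul]
    rw [hsupp]
    refine sum_smul_mem_GMM _ ?_ w g ?_ fun p _ ↦ (hg p).1
    -- The strict bound by `s₀.card + s₁.card ≤ K₀ + K₁` makes the truncated subtraction harmless.
    · simp only [Fintype.card_coe, ne_eq, NNReal.coe_eq_zero] at hcard
      simp only [ne_eq]
      omega
    · rw [← htotal]
      exact Finset.sum_filter_ne_zero _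
  have hfst : (∑ p, w p • g p).map Prod.fst = ∑ ν ∈ s₀, w₀ ν • ν := by
    rw [map_sum_smul _ _ _ measurable_fst, Fintype.sum_prod_type, ← Finset.sum_coe_sort s₀]
    refine Finset.sum_congr rfl fun i _ ↦ ?_
    rw [← hrow' i, Finset.sum_smul]
    exact Finset.sum_congr rfl fun j _ ↦ by rw [(hg (i, j)).2.1]
  have hsnd : (∑ p, w p • g p).map Prod.snd = ∑ ν ∈ s₁, w₁ ν • ν := by
    rw [map_sum_smul _ _ _ measurable_snd, Fintype.sum_prod_type_right, ← Finset.sum_coe_sort s₁]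
    refine Finset.sum_congr rfl fun j _ ↦ ?_
    rw [← hcol' j, Finset.sum_smul]
    exact Finset.sum_congr rfl fun i _ ↦ by rw [(hg (i, j)).2.2]
  have hprob : IsProbabilityMeasure (∑ p, w p • g p) := by
    refine ⟨?_⟩
    rw [Measure.finsetSum_apply]
    have : ∀ p, (w p • g p) Set.univ = w p := fun p ↦ by
      have := (hg p).1
      rw [Measure.smul_apply, measure_univ, ENNReal.smul_def, smul_eq_mul, mul_one]
    simp only [this]
    exact_mod_cast htotal
  have hplan : ∑ p, w p • g p ∈ transportPlans (∑ ν ∈ s₀, w₀ ν • ν) (∑ ν ∈ s₁, w₁ ν • ν) :=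
    ⟨hprob, hfst, hsnd⟩
  refine ⟨_, ⟨hplan, hGMM⟩, le_antisymm (le_iInf₂ fun γ hγ ↦ ?_)
    (iInf₂_le _ ⟨hplan, Set.mem_iUnion.2 ⟨_, hGMM⟩⟩)⟩
  obtain ⟨W, hWrow, hWcol, hWle⟩ := exists_discrete_plan_of_mem_GMMInf hG₀ hG₁ hγ.1 hγ.2
  refine le_trans ?_ hWle
  rw [quadCost_sum_smul]
  simp only [hgcost]
  rw [hcost, hcost]
  refine ENNReal.ofReal_le_ofReal (hmin (fun p ↦ (W p : ℝ)) ⟨fun p ↦ NNReal.coe_nonneg _,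
    fun i ↦ ?_, fun j ↦ ?_⟩)
  · beta_reduce; exact_mod_cast hWrow i
  · beta_reduce; exact_mod_cast hWcol j
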